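/- Let $F$ be a field of characteristic $0$ and let $A_1=A_1(F)=F\langle x,y\mid yx-xy=1\rangle$ be the first Weyl algebra, with $F$-basis $\{x^iy^j\}_{i,j\ge 0}$. Let $\Theta:A_1\to F[X,Y]$ be the $F$-linear isomorphism $\sum c_{ij}x^iy^j\mapsto\sum c_{ij}X^iY^j$ onto the commutative polynomial algebra. For $0\neq u\in A_1$, the $(1,1)$-degree of $u$ is the total degree of $\Theta(u)$, and the $(1,1)$-leading term $l_{1,1}(u)$ is the sum of the terms of $\Theta(u)$ of that total degree; a polynomial $\sum c_{ij}X^iY^j$ is also regarded as the element $\sum c_{ij}x^iy^j$ of $A_1$ (normal ordering). Let $\alpha$ be the exchange involution of $A_1$, i.e. the $F$-linear antiautomorphism with $\alpha(x)=y$, $\alpha(y)=x$; an element $u\in A_1$ is antisymmetric if $\alpha(u)=-u$. An $\alpha$-endomorphism of $A_1$ is an $F$-algebra endomorphism $f$ of $A_1$ with $f(\alpha(w))=\alpha(f(w))$ for all $w\in A_1$; its degree is the $(1,1)$-degree of $f(x)$. Let $f$ be an $\alpha$-endomorphism of $A_1$ whose degree is a prime $p>2$, and put $P=f(x)$. Then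 the $(1,1)$-leading term $l_{1,1}(P)$, regarded as an element of $A_1$, is antisymmetric. Moreover, there is $\lambda\in F$, $\lambda\neq 0$, such that $$l_{1,1}(P)=\lambda\,(X-Y)^p,$$ where $(X-Y)^p$ is computed in $F[X,Y]$ (and then, as an element of $A_1$, is obtained by replacing $X^iY^j$ by $x^iy^j$). -/

import Mathlib

namespace Weyl

open MvPolynomial

variable (R : Type*) [CommRing R]

/-- The defining relation `y x = x y + 1`, where `x` is the generator `0` and `y` the generator
`1` of the free algebra on two generators. -/
inductive Rel : FreeAlgebra R (Fin 2) → FreeAlgebra R (Fin 2) → Prop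
  | comm : Rel (FreeAlgebra.ι R 1 * FreeAlgebra.ι R 0)
      (FreeAlgebra.ι R 0 * FreeAlgebra.ι R 1 + 1)

/-- The first Weyl algebra `A₁(R) = R⟨x, y | y x - x y = 1⟩`. -/
abbrev A1 : Type _ := RingQuot (Rel R)

/-- The generator `x` of `A₁`. -/
noncomputable def x : A1 R := RingQuot.mkAlgHom R (Rel R) (FreeAlgebra.ι R 0)

/-- The generator `y` of `A₁`. -/
noncomputable def y : A1 R := RingQuot.mkAlgHom R (Rel R) (FreeAlgebra.ι R 1)

theorem y_mul_x : y R * x R = x R * y R + 1 := by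
  have h := RingQuot.mkAlgHom_rel R (Rel.comm (R := R))
  simpa [x, y] using h

variable {R}

/-- The universal property of `A₁`: the algebra homomorphism with `x ↦ a`, `y ↦ b`. -/
noncomputable def lift {B : Type*} [Ring B] [Algebra R B] (a b : B) (h : b * a = a * b + 1) :
    A1 R →ₐ[R] B :=
  RingQuot.liftAlgHom R ⟨FreeAlgebra.lift R ![a, b], by
    rintro _ _ ⟨⟩
    simpa using h⟩

@[simp] theorem lift_x {B : Type*} [Ring B] [Algebra R B] (a b : B) (h : b * a = a * b + 1) :
    lift (R := R) a b h (x R) = a := by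
  simp [lift, x]

@[simp] theorem lift_y {B : Type*} [Ring B] [Algebra R B] (a b : B) (h : b * a = a * b + 1) :
    lift (R := R) a b h (y R) = b := by
  simp [lift, y]

variable (R)

/-- The exchange involution, as a homomorphism from `A₁` to the opposite algebra. -/
noncomputable def exchangeOp : A1 R →ₐ[R] (A1 R)ᵐᵒᵖ :=
  lift (MulOpposite.op (y R)) (MulOpposite.op (x R)) (by
    rw [← MulOpposite.op_mul, y_mul_x]; simp)

/-- The exchange involution `α` of `A₁`: the antihomomorphism of algebras with `α(x) = y`,
`α(y) = x`. -/
noncomputable def exchange : A1 R →ₗ[R] A1 R :=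
  (MulOpposite.opLinearEquiv R).symm.toLinearMap ∘ₗ (exchangeOp R).toLinearMap

theorem exchange_x : exchange R (x R) = y R := by simp [exchange, exchangeOp]

theorem exchange_y : exchange R (y R) = x R := by simp [exchange, exchangeOp]

theorem exchange_one : exchange R 1 = 1 := by simp [exchange]

theorem exchange_mul (u v : A1 R) : exchange R (u * v) = exchange R v * exchange R u := by
  simp [exchange]

/-- The linear map `R[X, Y] → A₁` given by `X ^ i * Y ^ j ↦ x ^ i * y ^ j` (normal ordering:
compute in `R[X, Y]`, then replace `X, Y` by `x, y`). Here `X` is the variable `0` and `Y` the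
variable `1`. -/
noncomputable def normalOrder : MvPolynomial (Fin 2) R →ₗ[R] A1 R :=
  (MvPolynomial.basisMonomials (Fin 2) R).constr R fun m => x R ^ m 0 * y R ^ m 1

theorem normalOrder_monomial (m : Fin 2 →₀ ℕ) (c : R) :
    normalOrder R (monomial m c) = c • (x R ^ m 0 * y R ^ m 1) := by
  have h : (monomial m c : MvPolynomial (Fin 2) R) = c • basisMonomials (Fin 2) R m := by
    simp [MvPolynomial.smul_monomial]
  rw [h, map_smul, normalOrder, Module.Basis.constr_basis]

/-- The faithful representation of `A₁` on `R[X, Y]` in which `x` acts as multiplication by `X`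
and `y` as `Y + ∂/∂X`; it serves to show that the monomials `x ^ i * y ^ j` are independent. -/
noncomputable def rep : A1 R →ₐ[R] Module.End R (MvPolynomial (Fin 2) R) :=
  lift (LinearMap.mulLeft R (X 0))
    (LinearMap.mulLeft R (X 1) + (pderiv (0 : Fin 2)).toLinearMap) (by
      ext1 m
      ext1
      simp [Derivation.leibniz]
      ring)

theorem rep_normalOrder (P : MvPolynomial (Fin 2) R) : rep R (normalOrder R P) 1 = P := by
  have hy : ∀ j : ℕ, ((LinearMap.mulLeft R (X 1 : MvPolynomial (Fin 2) R) +
      (pderiv (0 : Fin 2)).toLinearMap) ^ j : Module.End R (MvPolynomial (Fin 2) R)) 1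
        = X 1 ^ j := by
    intro j
    induction j with
    | zero => simp
    | succ j ih =>
      rw [pow_succ', Module.End.mul_apply, ih]
      simp [Derivation.leibniz_pow, pow_succ', pderiv_X]
  induction P using MvPolynomial.induction_on' with
  | add p q hp hq => simp [hp, hq]
  | monomial m c =>
    rw [normalOrder_monomial]
    simp only [map_smul, map_mul, map_pow, rep, lift_x, lift_y, LinearMap.smul_apply,
      Module.End.mul_apply, hy, LinearMap.pow_mulLeft, LinearMap.mulLeft_apply]
    rw [monomial_eq, Finsupp.prod_fintype _ _ (by simp), Fin.prod_univ_two, smul_eq_C_mul]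

theorem normalOrder_bijective : Function.Bijective (normalOrder R) := by
  refine ⟨Function.LeftInverse.injective (g := fun u => rep R u 1) (rep_normalOrder R), ?_⟩
  have hx : ∀ u ∈ LinearMap.range (normalOrder R), x R * u ∈ LinearMap.range (normalOrder R) := by
    rintro _ ⟨P, rfl⟩
    induction P using MvPolynomial.induction_on' with
    | add p q hp hq => rw [map_add, mul_add]; exact add_mem hp hq
    | monomial m c =>
      refine ⟨monomial (m + Finsupp.single 0 1) c, ?_⟩
      simp [normalOrder_monomial, pow_succ', mul_assoc]
  have hc : ∀ i : ℕ, y R * x R ^ i = x R ^ i * y R + (i : R) • x R ^ (i - 1) := by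
    intro i
    induction i with
    | zero => simp
    | succ i ih =>
      rw [pow_succ, ← mul_assoc, ih, add_mul, mul_assoc, y_mul_x, mul_add, smul_mul_assoc,
        ← pow_succ]
      rcases i with _ | i
      · simp
      · simp only [Nat.add_sub_cancel, mul_assoc, Nat.cast_add, Nat.cast_one, add_smul, one_smul,
          pow_succ, mul_one]
        abel
  have hy : ∀ u ∈ LinearMap.range (normalOrder R), y R * u ∈ LinearMap.range (normalOrder R) := by
    rintro _ ⟨P, rfl⟩
    induction P using MvPolynomial.induction_on' with
    | add p q hp hq => rw [map_add, mul_add]; exact add_mem hp hq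
    | monomial m c =>
      refine ⟨monomial (m + Finsupp.single 1 1) c +
        monomial (m - Finsupp.single 0 1) (c * (m 0 : R)), ?_⟩
      rw [map_add, normalOrder_monomial, normalOrder_monomial, normalOrder_monomial,
        mul_smul_comm, ← mul_assoc, hc]
      simp [add_mul, mul_assoc, pow_succ', mul_smul]
  have key : ∀ a : FreeAlgebra R (Fin 2), ∀ u ∈ LinearMap.range (normalOrder R),
      RingQuot.mkAlgHom R (Rel R) a * u ∈ LinearMap.range (normalOrder R) := by
    intro a
    induction a using FreeAlgebra.induction with
    | grade0 r =>
      intro u hu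
      rw [AlgHom.commutes, ← Algebra.smul_def]
      exact Submodule.smul_mem _ _ hu
    | grade1 i =>
      intro u hu
      fin_cases i
      · exact hx u hu
      · exact hy u hu
    | mul a b ha hb =>
      intro u hu
      rw [map_mul, mul_assoc]
      exact ha _ (hb _ hu)
    | add a b ha hb =>
      intro u hu
      rw [map_add, add_mul]
      exact add_mem (ha _ hu) (hb _ hu)
  intro u
  obtain ⟨a, rfl⟩ := RingQuot.mkAlgHom_surjective R (Rel R) u
  have h1 : (1 : A1 R) ∈ LinearMap.range (normalOrder R) :=
    ⟨monomial 0 1, by rw [normalOrder_monomial]; simp⟩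
  simpa using key a 1 h1

/-- The linear isomorphism `Θ : A₁ → R[X, Y]`, `∑ cᵢⱼ x ^ i * y ^ j ↦ ∑ cᵢⱼ X ^ i * Y ^ j`. -/
noncomputable def Theta : A1 R ≃ₗ[R] MvPolynomial (Fin 2) R :=
  (LinearEquiv.ofBijective (normalOrder R) (normalOrder_bijective R)).symm

variable {R}

/-- The `(r, s)` degree of the monomial `X ^ i * Y ^ j`, namely `r i + s j`. -/
def weight (r s : ℤ) (m : Fin 2 →₀ ℕ) : ℤ := r * (m 0 : ℤ) + s * (m 1 : ℤ)

/-- The `(r, s)` degree of a polynomial: the maximum of `r i + s j` over its support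
(and `⊥` for the zero polynomial). -/
noncomputable def polyDegree (r s : ℤ) (P : MvPolynomial (Fin 2) R) : WithBot ℤ :=
  P.support.sup fun m => (weight r s m : WithBot ℤ)

/-- The `(r, s)` leading term of a polynomial: the sum of its terms of maximal `(r, s)` degree. -/
noncomputable def polyLeadingTerm (r s : ℤ) (P : MvPolynomial (Fin 2) R) :
    MvPolynomial (Fin 2) R :=
  ∑ m ∈ P.support with (weight r s m : WithBot ℤ) = polyDegree r s P, monomial m (P.coeff m)

/-- The `(r, s)` degree of an element of `A₁`. -/
noncomputable def degree (r s : ℤ) (u : A1 R) : WithBot ℤ := polyDegree r s (Theta R u)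

/-- The `(r, s)` leading term of an element of `A₁`, a polynomial in the commuting variables
`X, Y`. -/
noncomputable def leadingTerm (r s : ℤ) (u : A1 R) : MvPolynomial (Fin 2) R :=
  polyLeadingTerm r s (Theta R u)

/-- An element of `A₁` is antisymmetric if the exchange involution maps it to its negative. -/
def IsAntisymmetric (u : A1 R) : Prop := exchange R u = -u

/-- An `α`-endomorphism of `A₁` is an algebra endomorphism commuting with the exchange
involution. -/
def IsAlphaEndomorphism (f : A1 R →ₐ[R] A1 R) : Prop :=
  ∀ w : A1 R, f (exchange R w) = exchange R (f w)

/-- The degree of an `α`-endomorphism `f` is `n` if the `(1, 1)` degree of `f x` is `n`. -/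
def HasDegree (f : A1 R →ₐ[R] A1 R) (n : ℕ) : Prop := degree 1 1 (f (x R)) = ((n : ℤ) : WithBot ℤ)

end Weyl

/-! Put `U = Θ(f x)`. Then `Θ(f y)` is `U` with the variables exchanged, and `[f y, f x] = 1`. A
commutator agrees with the Poisson bracket of the symbols up to terms two degrees lower
(`Theta_commutator_sub_poisson_mem`), so when a commutator is `1` the top forms Poisson commute,
except in total degree two. Let `A` be the top form of `U`. Its exchange has the same degree and
Poisson commutes with `A`, hence equals `c A`, and `c = ±1` because the exchange is an involution.
The element `f y - c f x` still has commutator `1` with `f x`, and its top form `B` has degree `m`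
with `0 < m < p`. Now `A ^ m` is proportional to `B ^ p` with `m` prime to `p`, so `A` is a scalar
times the `p`-th power of a linear form, which the symmetry makes proportional to `X + c Y`. If `c =
1`, then `B` is antisymmetric under the exchange and vanishes at `(1, 1)`, hence so does `A`; but
`(X + Y) ^ p` does not. So `c = -1`. -/

namespace Weyl

open MvPolynomial

variable {F : Type*} [Field F]

/-! ### The filtration by total degree, with integer bounds so that negative ones give zero -/

/-- The polynomials all of whose terms have total degree at most `n`. -/
def degreeLE (F : Type*) [Field F] (n : ℤ) : Submodule F (MvPolynomial (Fin 2) F) where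
  carrier := {P | ∀ m, coeff m P ≠ 0 → (m.degree : ℤ) ≤ n}
  zero_mem' := by intro m h; simp at h
  add_mem' := by
    intro P Q hP hQ m h
    by_cases h1 : coeff m P = 0
    · exact hQ m (by simpa [h1] using h)
    · exact hP m h1
  smul_mem' := by
    intro c P hP m h
    exact hP m (by intro h0; simp [h0] at h)

theorem mem_degreeLE {n : ℤ} {P : MvPolynomial (Fin 2) F} :
    P ∈ degreeLE F n ↔ ∀ m, coeff m P ≠ 0 → (m.degree : ℤ) ≤ n := Iff.rfl

theorem degreeLE_mono {a b : ℤ} (h : a ≤ b) {P : MvPolynomial (Fin 2) F}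
    (hP : P ∈ degreeLE F a) : P ∈ degreeLE F b := fun m hm => (hP m hm).trans h

theorem monomial_mem_degreeLE {n : ℤ} {m : Fin 2 →₀ ℕ} (c : F) (h : (m.degree : ℤ) ≤ n) :
    monomial m c ∈ degreeLE F n := by
  intro k hk
  rw [coeff_monomial] at hk
  split_ifs at hk with h1
  · rwa [← h1]
  · exact absurd rfl hk

theorem degreeLE_le_of_monomial_mem {n : ℤ} (S : Submodule F (MvPolynomial (Fin 2) F))
    (hS : ∀ (m : Fin 2 →₀ ℕ) (c : F), (m.degree : ℤ) ≤ n → monomial m c ∈ S) :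
    degreeLE F n ≤ S := by
  intro P hP
  rw [P.as_sum]
  exact Submodule.sum_mem _ fun m hm => hS m _ (hP m (mem_support_iff.1 hm))

theorem mul_mem_degreeLE {a b : ℤ} {P Q : MvPolynomial (Fin 2) F}
    (hP : P ∈ degreeLE F a) (hQ : Q ∈ degreeLE F b) : P * Q ∈ degreeLE F (a + b) := by
  classical
  intro m hm
  obtain ⟨k, hk, l, hl, rfl⟩ := Finset.mem_add.1 (support_mul P Q (mem_support_iff.2 hm))
  have h1 := hP k (mem_support_iff.1 hk)
  have h2 := hQ l (mem_support_iff.1 hl)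
  rw [map_add]
  push_cast
  linarith

theorem X_mem_degreeLE (i : Fin 2) : (X i : MvPolynomial (Fin 2) F) ∈ degreeLE F 1 :=
  monomial_mem_degreeLE _ (by simp)

theorem X_pow_mem_degreeLE (i : Fin 2) (n : ℕ) :
    (X i ^ n : MvPolynomial (Fin 2) F) ∈ degreeLE F n := by
  rw [X_pow_eq_monomial]
  exact monomial_mem_degreeLE _ (by simp)

theorem pderiv_mem_degreeLE {a : ℤ} {P : MvPolynomial (Fin 2) F} (i : Fin 2)
    (hP : P ∈ degreeLE F a) : pderiv i P ∈ degreeLE F (a - 1) := by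
  suffices h : degreeLE F a ≤ (degreeLE F (a - 1)).comap (pderiv i).toLinearMap from h hP
  refine degreeLE_le_of_monomial_mem _ ?_
  intro m c hm
  change pderiv i (monomial m c) ∈ degreeLE F (a - 1)
  rw [pderiv_monomial]
  by_cases h0 : m i = 0
  · simp [h0]
  · refine monomial_mem_degreeLE _ ?_
    have : (m - Finsupp.single i 1).degree + 1 = m.degree := by
      conv_rhs => rw [← tsub_add_cancel_of_le (a := Finsupp.single i 1) (b := m)
        (by simpa [Finsupp.single_le_iff] using Nat.one_le_iff_ne_zero.2 h0)]
      simp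
    omega

theorem _root_.MvPolynomial.IsHomogeneous.mem_degreeLE {n : ℕ} {P : MvPolynomial (Fin 2) F}
    (hP : P.IsHomogeneous n) : P ∈ degreeLE F n := by
  intro m hm
  by_contra h
  exact hm (hP.coeff_eq_zero (by omega))

theorem sub_homogeneousComponent_mem_degreeLE {n : ℕ} {P : MvPolynomial (Fin 2) F}
    (hP : P ∈ degreeLE F n) : P - homogeneousComponent n P ∈ degreeLE F (n - 1) := by
  intro m hm
  rw [coeff_sub, coeff_homogeneousComponent] at hm
  split_ifs at hm with h
  · simp at hm
  · have := hP m (by simpa using hm)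
    omega

theorem _root_.MvPolynomial.IsHomogeneous.eq_zero_of_mem_degreeLE {n : ℕ} {a : ℤ}
    {P : MvPolynomial (Fin 2) F} (hP : P.IsHomogeneous n) (ha : P ∈ degreeLE F a) (h : a < n) :
    P = 0 := by
  ext m
  by_contra hm
  have h1 := ha m hm
  have h2 : m.degree = n := by
    by_contra h2
    exact hm (hP.coeff_eq_zero h2)
  omega

/-! ### Products and commutators to second order -/

/-- The operator `Y + ∂/∂X` by which `y` acts in the representation `rep`. -/
noncomputable def repY (F : Type*) [Field F] : Module.End F (MvPolynomial (Fin 2) F) :=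
  LinearMap.mulLeft F (X 1) + (pderiv (0 : Fin 2)).toLinearMap

theorem repY_apply (P : MvPolynomial (Fin 2) F) : repY F P = X 1 * P + pderiv 0 P := rfl

/-- Replacing a factor `Y` by `∂/∂X` lowers the degree by two, so the terms with at least two
derivatives lie four below the top. Writing `j Y ^ (j - 1)` as a derivative avoids truncated
subtraction. -/
theorem repY_pow_sub_mem {b : ℤ} {B : MvPolynomial (Fin 2) F} (hB : B ∈ degreeLE F b) (j : ℕ) :
    (repY F ^ j) B - X 1 ^ j * B - pderiv 1 (X 1 ^ j) * pderiv 0 B ∈ degreeLE F (j + b - 4) := by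
  induction j with
  | zero => simp
  | succ j ih =>
    set E := (repY F ^ j) B - X 1 ^ j * B - pderiv 1 (X 1 ^ j) * pderiv 0 B with hE
    have h1 : X 1 * E ∈ degreeLE F ((j + 1 : ℕ) + b - 4) := by
      convert! mul_mem_degreeLE (X_mem_degreeLE 1) ih using 2
      push_cast; ring
    have h2 : pderiv 0 E ∈ degreeLE F ((j + 1 : ℕ) + b - 4) :=
      degreeLE_mono (by push_cast; linarith) (pderiv_mem_degreeLE 0 ih)
    have h3 : pderiv 1 (X 1 ^ j) * pderiv 0 (pderiv 0 B) ∈ degreeLE F ((j + 1 : ℕ) + b - 4) := by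
      convert! mul_mem_degreeLE (pderiv_mem_degreeLE 1 (X_pow_mem_degreeLE 1 j))
        (pderiv_mem_degreeLE 0 (pderiv_mem_degreeLE 0 hB)) using 2
      push_cast; ring
    have h4 : pderiv 0 (pderiv 1 (X 1 ^ j : MvPolynomial (Fin 2) F)) = 0 := by
      simp [Derivation.leibniz_pow, pderiv_X]
    have h5 : pderiv 0 (X 1 ^ j : MvPolynomial (Fin 2) F) = 0 := by
      simp [Derivation.leibniz_pow, pderiv_X]
    have h6 : pderiv 1 (X 1 ^ (j + 1) : MvPolynomial (Fin 2) F)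
        = X 1 * pderiv 1 (X 1 ^ j) + X 1 ^ j := by
      rw [pow_succ', Derivation.leibniz]
      simp
    have h7 : (repY F ^ j) B = E + X 1 ^ j * B + pderiv 1 (X 1 ^ j) * pderiv 0 B := by
      rw [hE]; ring
    convert! add_mem (add_mem h1 h2) h3 using 1
    rw [pow_succ' (repY F), Module.End.mul_apply, h7, repY_apply]
    simp only [map_add, Derivation.leibniz, h4, h5, h6, smul_eq_mul]
    ring

theorem rep_monomial (m : Fin 2 →₀ ℕ) (c : F) (B : MvPolynomial (Fin 2) F) :
    rep F (normalOrder F (monomial m c)) B = c • (X 0 ^ m 0 * (repY F ^ m 1) B) := by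
  rw [normalOrder_monomial]
  simp [rep, repY, LinearMap.pow_mulLeft]

theorem monomial_eq_smul (m : Fin 2 →₀ ℕ) (c : F) :
    (monomial m c : MvPolynomial (Fin 2) F) = c • (X 0 ^ m 0 * X 1 ^ m 1) := by
  rw [monomial_eq, Finsupp.prod_fintype _ _ (by simp), Fin.prod_univ_two, smul_eq_C_mul]

theorem rep_normalOrder_sub_mem {a b : ℤ} {A B : MvPolynomial (Fin 2) F}
    (hA : A ∈ degreeLE F a) (hB : B ∈ degreeLE F b) :
    rep F (normalOrder F A) B - A * B - pderiv 1 A * pderiv 0 B ∈ degreeLE F (a + b - 4) := by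
  let T : MvPolynomial (Fin 2) F →ₗ[F] MvPolynomial (Fin 2) F :=
    (LinearMap.applyₗ B) ∘ₗ (rep F).toLinearMap ∘ₗ normalOrder F - LinearMap.mulRight F B
      - LinearMap.mulRight F (pderiv 0 B) ∘ₗ (pderiv 1).toLinearMap
  suffices h : degreeLE F a ≤ (degreeLE F (a + b - 4)).comap T from h hA
  refine degreeLE_le_of_monomial_mem _ ?_
  intro m c hm
  have h1 : T (monomial m c) = c • (X 0 ^ m 0 *
      ((repY F ^ m 1) B - X 1 ^ m 1 * B - pderiv 1 (X 1 ^ m 1) * pderiv 0 B)) := by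
    change rep F (normalOrder F (monomial m c)) B - monomial m c * B
      - pderiv 1 (monomial m c) * pderiv 0 B = _
    have h2 : pderiv 1 (X 0 ^ m 0 : MvPolynomial (Fin 2) F) = 0 := by
      simp [Derivation.leibniz_pow, pderiv_X]
    rw [rep_monomial, monomial_eq_smul, Derivation.map_smul, Derivation.leibniz, h2]
    simp only [smul_eq_C_mul, smul_eq_mul]
    ring
  rw [Submodule.mem_comap, h1]
  refine Submodule.smul_mem _ _ (degreeLE_mono ?_
    (mul_mem_degreeLE (X_pow_mem_degreeLE 0 (m 0)) (repY_pow_sub_mem hB (m 1))))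
  have : (m.degree : ℤ) = m 0 + m 1 := by
    rw [Finsupp.degree_eq_sum, Fin.sum_univ_two]; push_cast; rfl
  linarith

theorem normalOrder_Theta (u : A1 F) : normalOrder F (Theta F u) = u :=
  LinearEquiv.apply_symm_apply (LinearEquiv.ofBijective _ (normalOrder_bijective F)) u

theorem Theta_normalOrder (P : MvPolynomial (Fin 2) F) : Theta F (normalOrder F P) = P :=
  LinearEquiv.symm_apply_apply (LinearEquiv.ofBijective _ (normalOrder_bijective F)) P

/-- Through `Θ`, `rep` is left multiplication, so the expansion above computes products in `A₁`. -/
theorem rep_apply_normalOrder (u : A1 F) (B : MvPolynomial (Fin 2) F) :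
    rep F u B = Theta F (u * normalOrder F B) := by
  rw [← rep_normalOrder F (Theta F (u * normalOrder F B)), normalOrder_Theta, map_mul,
    Module.End.mul_apply, rep_normalOrder]

/-- The Poisson bracket `∂A/∂Y ∂B/∂X - ∂A/∂X ∂B/∂Y`. -/
noncomputable def poisson (A B : MvPolynomial (Fin 2) F) : MvPolynomial (Fin 2) F :=
  pderiv 1 A * pderiv 0 B - pderiv 0 A * pderiv 1 B

theorem Theta_commutator_sub_poisson_mem {a b : ℤ} {u v : A1 F}
    (hu : Theta F u ∈ degreeLE F a) (hv : Theta F v ∈ degreeLE F b) :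
    Theta F (u * v - v * u) - poisson (Theta F u) (Theta F v) ∈ degreeLE F (a + b - 4) := by
  have h1 := rep_normalOrder_sub_mem hu hv
  have h2 := rep_normalOrder_sub_mem hv hu
  rw [rep_apply_normalOrder, normalOrder_Theta, normalOrder_Theta] at h1 h2
  rw [add_comm b a] at h2
  convert! sub_mem h1 h2 using 1
  rw [map_sub, poisson]
  ring

theorem poisson_isHomogeneous {a b : ℕ} {A B : MvPolynomial (Fin 2) F}
    (hA : A.IsHomogeneous a) (hB : B.IsHomogeneous b) :
    (poisson A B).IsHomogeneous (a - 1 + (b - 1)) :=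
  (hA.pderiv.mul hB.pderiv).sub (hA.pderiv.mul hB.pderiv)

theorem pderiv_mul_pderiv_sub_mem_degreeLE (i j : Fin 2) {a b : ℤ}
    {A B U V : MvPolynomial (Fin 2) F} (hA : A ∈ degreeLE F a) (hV : V ∈ degreeLE F b)
    (hUA : U - A ∈ degreeLE F (a - 1)) (hVB : V - B ∈ degreeLE F (b - 1)) :
    pderiv i U * pderiv j V - pderiv i A * pderiv j B ∈ degreeLE F (a + b - 3) := by
  have e : pderiv i U * pderiv j V - pderiv i A * pderiv j B =
      pderiv i (U - A) * pderiv j V + pderiv i A * pderiv j (V - B) := by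
    simp only [map_sub]
    ring
  rw [e]
  exact add_mem
    (degreeLE_mono (by linarith)
      (mul_mem_degreeLE (pderiv_mem_degreeLE i hUA) (pderiv_mem_degreeLE j hV)))
    (degreeLE_mono (by linarith)
      (mul_mem_degreeLE (pderiv_mem_degreeLE i hA) (pderiv_mem_degreeLE j hVB)))

/-- If `[u, v] = 1` then the forms of top degree of `u` and `v` Poisson commute, unless the
degrees add up to `2`. -/
theorem poisson_homogeneousComponent_eq_zero {a b : ℕ} (ha : 0 < a) (hb : 0 < b) (hab : 2 < a + b)
    {u v : A1 F} (hu : Theta F u ∈ degreeLE F a) (hv : Theta F v ∈ degreeLE F b)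
    (huv : u * v - v * u = 1) :
    poisson (homogeneousComponent a (Theta F u)) (homogeneousComponent b (Theta F v)) = 0 := by
  set A := homogeneousComponent a (Theta F u) with hA
  set B := homogeneousComponent b (Theta F v) with hB
  have hAh : A.IsHomogeneous a := homogeneousComponent_isHomogeneous _ _
  have hBh : B.IsHomogeneous b := homogeneousComponent_isHomogeneous _ _
  have h0 := degreeLE_mono (b := (a + b - 3 : ℤ)) (by linarith)
    (Theta_commutator_sub_poisson_mem hu hv)
  have h1 : Theta F (u * v - v * u) ∈ degreeLE F (a + b - 3 : ℤ) := by
    have : (1 : A1 F) = normalOrder F (monomial 0 1) := by rw [normalOrder_monomial]; simp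
    rw [huv, this, Theta_normalOrder]
    -- The constant `1` fits under the bound because `2 < a + b`.
    exact monomial_mem_degreeLE _ (by simp; omega)
  have h2 := sub_mem h1 h0
  rw [sub_sub_cancel] at h2
  have hU := sub_homogeneousComponent_mem_degreeLE hu
  have hV := sub_homogeneousComponent_mem_degreeLE hv
  rw [← hA] at hU
  rw [← hB] at hV
  have key := fun i j : Fin 2 =>
    pderiv_mul_pderiv_sub_mem_degreeLE i j hAh.mem_degreeLE hv hU hV
  have h3 : poisson A B ∈ degreeLE F (a + b - 3 : ℤ) := by
    have e : poisson A B = poisson (Theta F u) (Theta F v) -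
        ((pderiv 1 (Theta F u) * pderiv 0 (Theta F v) - pderiv 1 A * pderiv 0 B) -
        (pderiv 0 (Theta F u) * pderiv 1 (Theta F v) - pderiv 0 A * pderiv 1 B)) := by
      simp only [poisson]
      ring
    rw [e]
    exact sub_mem h2 (sub_mem (key 1 0) (key 0 1))
  -- Positivity of `a` and `b` makes the truncated degree `a - 1 + (b - 1)` equal to `a + b - 2`,
  -- just above the bound.
  exact (poisson_isHomogeneous hAh hBh).eq_zero_of_mem_degreeLE h3 (by omega)

end Weyl
-- One-variable polynomials: vanishing Wronskians and proportional powers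
namespace Weyl

open Polynomial

variable {F : Type*} [Field F]

theorem coeff_X_mul_derivative (w : F[X]) (n : ℕ) :
    (X * derivative w).coeff n = n * w.coeff n := by
  cases n with
  | zero => simp
  | succ n => rw [coeff_X_mul, coeff_derivative]; push_cast; ring

/-- The top coefficient of `X (u w' - u' w)` is `deg w - deg u` times the two leading coefficients.
The factor `X` makes `X d/dX` act diagonally on coefficients. -/
theorem natDegree_eq_of_mul_derivative_eq [CharZero F] {u w : F[X]} (hu : u ≠ 0) (hw : w ≠ 0)
    (h : u * derivative w = derivative u * w) : w.natDegree = u.natDegree := by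
  have hX : ∀ v : F[X], (X * derivative v).natDegree ≤ v.natDegree := by
    intro v
    refine natDegree_le_iff_coeff_eq_zero.2 fun n hn => ?_
    rw [coeff_X_mul_derivative, coeff_eq_zero_of_natDegree_lt hn, mul_zero]
  have h1 : u * (X * derivative w) = (X * derivative u) * w := by linear_combination X * h
  have h2 := congrArg (fun q => q.coeff (u.natDegree + w.natDegree)) h1
  rw [coeff_mul_add_eq_of_natDegree_le le_rfl (hX w), coeff_mul_add_eq_of_natDegree_le (hX u) le_rfl,
    coeff_X_mul_derivative, coeff_X_mul_derivative] at h2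
  have h3 : u.coeff u.natDegree ≠ 0 := leadingCoeff_ne_zero.2 hu
  have h4 : w.coeff w.natDegree ≠ 0 := leadingCoeff_ne_zero.2 hw
  have h5 : ((w.natDegree : F) - u.natDegree) * (u.coeff u.natDegree * w.coeff w.natDegree) = 0 := by
    linear_combination h2
  have h6 := (mul_eq_zero.1 h5).resolve_right (mul_ne_zero h3 h4)
  exact_mod_cast sub_eq_zero.1 h6

/-- Cancelling leading terms, `v - c u` solves the same equation; if nonzero it would have the
degree of `u`, where its coefficient vanishes. -/
theorem eq_C_mul_of_mul_derivative_eq [CharZero F] {u v : F[X]} (hu : u ≠ 0)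
    (h : u * derivative v = derivative u * v) : ∃ c : F, v = C c * u := by
  by_cases hv : v = 0
  · exact ⟨0, by simp [hv]⟩
  have hd := natDegree_eq_of_mul_derivative_eq hu hv h
  refine ⟨v.leadingCoeff / u.leadingCoeff, ?_⟩
  by_contra hne
  set c := v.leadingCoeff / u.leadingCoeff with hc
  have hlu : u.leadingCoeff ≠ 0 := leadingCoeff_ne_zero.2 hu
  have hw : v - C c * u ≠ 0 := sub_ne_zero.2 hne
  have hwd := natDegree_eq_of_mul_derivative_eq hu hw (by
    rw [derivative_sub, derivative_C_mul]
    linear_combination h)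
  have : (v - C c * u).leadingCoeff = 0 := by
    rw [leadingCoeff, hwd, coeff_sub, coeff_C_mul]
    nth_rewrite 1 [← hd]
    change v.leadingCoeff - c * u.leadingCoeff = 0
    rw [hc, div_mul_cancel₀ _ hlu, sub_self]
  exact hw (leadingCoeff_eq_zero.1 this)

/-- With `m u = n v + 1`, the `u`-th power of the relation reads `a (a ^ v) ^ n = k ^ u (b ^ u) ^
n`. Unique factorization gives `a ^ v ∣ b ^ u`, and the quotient is the root. -/
theorem exists_eq_C_mul_pow_of_pow_eq {m n : ℕ} (hn : 1 < n) (hmn : m.Coprime n) {a b : F[X]}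
    (ha : a ≠ 0) {k : F} (hk : k ≠ 0) (h : a ^ m = C k * b ^ n) :
    ∃ (c : F) (r : F[X]), a = C c * r ^ n := by
  obtain ⟨u, hu⟩ := Nat.exists_mul_mod_eq_one_of_coprime hmn hn
  obtain ⟨v, hv⟩ : ∃ v, m * u = n * v + 1 := ⟨m * u / n, by
    have := Nat.div_add_mod (m * u) n
    omega⟩
  have h1 : a * (a ^ v) ^ n = C (k ^ u) * (b ^ u) ^ n := by
    have := congrArg (· ^ u) h
    simp only [mul_pow, ← pow_mul, hv] at this
    rw [← pow_mul, ← pow_mul, mul_comm v, mul_comm u, C_pow, ← this, pow_succ']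
  have hk' : k ^ u ≠ 0 := pow_ne_zero _ hk
  have h2 : (a ^ v) ^ n ∣ (b ^ u) ^ n :=
    ((isUnit_C.2 hk'.isUnit).dvd_mul_left).1 (Dvd.intro_left a h1)
  obtain ⟨r, hr⟩ := (UniqueFactorizationMonoid.pow_dvd_pow_iff_dvd (by omega)).1 h2
  refine ⟨k ^ u, r, mul_right_cancel₀ (pow_ne_zero n (pow_ne_zero v ha)) ?_⟩
  rw [h1, hr, mul_pow]
  ring

end Weyl

/-! ### The exchange of variables and binary forms -/

namespace Weyl

open MvPolynomial

variable {F : Type*} [Field F]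

/-- Reversing the product sends `x ^ i y ^ j` to `x ^ j y ^ i`, already normally ordered, so no
correction terms arise. -/
theorem Theta_exchange (u : A1 F) :
    Theta F (exchange F u) = rename (Equiv.swap 0 1) (Theta F u) := by
  obtain ⟨P, rfl⟩ := (normalOrder_bijective F).2 u
  have hpow : ∀ (w : A1 F) (n : ℕ), exchange F (w ^ n) = exchange F w ^ n := by
    intro w n
    induction n with
    | zero => simp [exchange_one]
    | succ n ih => rw [pow_succ, exchange_mul, ih, pow_succ']
  suffices h : exchange F (normalOrder F P) = normalOrder F (rename (Equiv.swap 0 1) P) by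
    rw [h, Theta_normalOrder, Theta_normalOrder]
  induction P using MvPolynomial.induction_on' with
  | add p q hp hq => simp [hp, hq]
  | monomial m c =>
    rw [rename_monomial, normalOrder_monomial, normalOrder_monomial, map_smul, exchange_mul,
      hpow, hpow, exchange_x, exchange_y, ← Finsupp.equivMapDomain_eq_mapDomain]
    simp [Finsupp.equivMapDomain_apply]

/-- The substitution `X ↦ 1`, `Y ↦ T` from `F[X, Y]` to `F[T]`. -/
noncomputable def dehomogenize (F : Type*) [Field F] :
    MvPolynomial (Fin 2) F →ₐ[F] Polynomial F :=
  aeval ![1, Polynomial.X]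

theorem dehomogenize_monomial (m : Fin 2 →₀ ℕ) (c : F) :
    dehomogenize F (monomial m c) = Polynomial.monomial (m 1) c := by
  rw [dehomogenize, aeval_monomial, Finsupp.prod_fintype _ _ (by simp), Fin.prod_univ_two]
  simp [Polynomial.C_mul_X_pow_eq_monomial]

theorem dehomogenize_eq_sum (A : MvPolynomial (Fin 2) F) :
    dehomogenize F A = ∑ m ∈ A.support, Polynomial.monomial (m 1) (coeff m A) := by
  conv_lhs => rw [A.as_sum]
  rw [map_sum]
  exact Finset.sum_congr rfl fun m _ => dehomogenize_monomial m _

theorem degree_fin_two (m : Fin 2 →₀ ℕ) : m.degree = m 0 + m 1 := by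
  rw [Finsupp.degree_eq_sum, Fin.sum_univ_two]

theorem coeff_dehomogenize {n : ℕ} {A : MvPolynomial (Fin 2) F} (hA : A.IsHomogeneous n)
    {m : Fin 2 →₀ ℕ} (hm : m.degree = n) : (dehomogenize F A).coeff (m 1) = coeff m A := by
  rw [dehomogenize_eq_sum, Polynomial.finsetSum_coeff, Finset.sum_eq_single m]
  · simp
  · intro k hk hkm
    rw [Polynomial.coeff_monomial, if_neg]
    intro h
    have h1 : k.degree = n := by
      by_contra h1
      exact mem_support_iff.1 hk (hA.coeff_eq_zero h1)
    rw [degree_fin_two] at h1 hm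
    apply hkm
    ext i
    fin_cases i
    · change k 0 = m 0
      omega
    · exact h
  · intro h
    simp [notMem_support_iff.1 h]

theorem dehomogenize_injOn {n : ℕ} {A B : MvPolynomial (Fin 2) F} (hA : A.IsHomogeneous n)
    (hB : B.IsHomogeneous n) (h : dehomogenize F A = dehomogenize F B) : A = B := by
  ext m
  by_cases hm : m.degree = n
  · rw [← coeff_dehomogenize hA hm, ← coeff_dehomogenize hB hm, h]
  · rw [hA.coeff_eq_zero hm, hB.coeff_eq_zero hm]

theorem natDegree_dehomogenize_le {n : ℕ} {A : MvPolynomial (Fin 2) F} (hA : A.IsHomogeneous n) :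
    (dehomogenize F A).natDegree ≤ n := by
  rw [dehomogenize_eq_sum]
  refine Polynomial.natDegree_sum_le_of_forall_le _ _ fun m hm => ?_
  refine (Polynomial.natDegree_monomial_le _).trans ?_
  have h1 : m.degree = n := by
    by_contra h1
    exact mem_support_iff.1 hm (hA.coeff_eq_zero h1)
  rw [degree_fin_two] at h1
  omega

theorem derivative_dehomogenize (A : MvPolynomial (Fin 2) F) :
    Polynomial.derivative (dehomogenize F A) = dehomogenize F (pderiv 1 A) := by
  induction A using MvPolynomial.induction_on' with
  | add p q hp hq => simp [hp, hq]
  | monomial m c =>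
    rw [pderiv_monomial, dehomogenize_monomial, dehomogenize_monomial,
      Polynomial.derivative_monomial]
    simp

theorem eval_one_dehomogenize (A : MvPolynomial (Fin 2) F) :
    (dehomogenize F A).eval 1 = eval (fun _ => 1) A := by
  induction A using MvPolynomial.induction_on' with
  | add p q hp hq => simp [hp, hq]
  | monomial m c => simp [dehomogenize_monomial, eval_monomial]

/-- Euler's identity eliminates `X ∂/∂X` from `X` times the bracket. -/
theorem mul_derivative_of_poisson_eq_zero {a b : ℕ} {A B : MvPolynomial (Fin 2) F}
    (hA : A.IsHomogeneous a) (hB : B.IsHomogeneous b) (h : poisson A B = 0) :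
    (a : Polynomial F) * (dehomogenize F A * Polynomial.derivative (dehomogenize F B)) =
      b * (Polynomial.derivative (dehomogenize F A) * dehomogenize F B) := by
  have eA := hA.sum_X_mul_pderiv
  have eB := hB.sum_X_mul_pderiv
  rw [Fin.sum_univ_two, nsmul_eq_mul] at eA eB
  have key : (a : MvPolynomial (Fin 2) F) * (A * pderiv 1 B) = b * (pderiv 1 A * B) := by
    rw [poisson] at h
    linear_combination (-pderiv 1 B) * eA + pderiv 1 A * eB - X 0 * h
  simpa [derivative_dehomogenize] using congrArg (dehomogenize F) key

theorem dehomogenize_ne_zero {n : ℕ} {A : MvPolynomial (Fin 2) F} (hA : A.IsHomogeneous n)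
    (h0 : A ≠ 0) : dehomogenize F A ≠ 0 := fun h =>
  h0 (dehomogenize_injOn hA (isHomogeneous_zero _ _ _) (by rw [h, map_zero]))

/-- Poisson commuting forms have proportional powers. -/
theorem exists_pow_eq_of_poisson_eq_zero [CharZero F] {a b : ℕ} {A B : MvPolynomial (Fin 2) F}
    (hA : A.IsHomogeneous a) (hB : B.IsHomogeneous b) (hA0 : A ≠ 0) (h : poisson A B = 0) :
    ∃ c : F, dehomogenize F B ^ a = Polynomial.C c * dehomogenize F A ^ b := by
  refine eq_C_mul_of_mul_derivative_eq (pow_ne_zero _ (dehomogenize_ne_zero hA hA0)) ?_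
  have key := mul_derivative_of_poisson_eq_zero hA hB h
  rw [Polynomial.derivative_pow, Polynomial.derivative_pow]
  have hder : ∀ {Q : MvPolynomial (Fin 2) F}, Q.IsHomogeneous 0 →
      Polynomial.derivative (dehomogenize F Q) = 0 := fun hQ =>
    Polynomial.derivative_of_natDegree_zero (Nat.le_zero.1 (natDegree_dehomogenize_le hQ))
  -- Degree zero is separate, since the exponents `a - 1` and `b - 1` truncate; there the derivative
  -- vanishes.
  rcases a with _ | a
  · simp [hder hA]
  · rcases b with _ | b
    · simp [hder hB]
    · simp only [Nat.add_sub_cancel, Polynomial.C_eq_natCast]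
      linear_combination dehomogenize F A ^ b * dehomogenize F B ^ a * key

theorem exists_eq_C_mul_of_poisson_eq_zero [CharZero F] {n : ℕ} (hn : n ≠ 0)
    {A B : MvPolynomial (Fin 2) F}
    (hA : A.IsHomogeneous n) (hB : B.IsHomogeneous n) (hA0 : A ≠ 0) (h : poisson A B = 0) :
    ∃ c : F, B = C c * A := by
  have key := mul_derivative_of_poisson_eq_zero hA hB h
  obtain ⟨c, hc⟩ := eq_C_mul_of_mul_derivative_eq (dehomogenize_ne_zero hA hA0)
    (mul_left_cancel₀ (Nat.cast_ne_zero.2 hn) key)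
  refine ⟨c, dehomogenize_injOn hB (hA.C_mul c) ?_⟩
  rw [hc, map_mul]
  simp [dehomogenize]

/-- A form of degree `n` that Poisson commutes with a form of degree prime to `n` is proportional
to the `n`-th power of a linear form. -/
theorem exists_eq_linear_pow_of_poisson_eq_zero [CharZero F] {m n : ℕ} (hn : 1 < n)
    (hmn : m.Coprime n) {A B : MvPolynomial (Fin 2) F} (hA : A.IsHomogeneous n)
    (hB : B.IsHomogeneous m) (hA0 : A ≠ 0) (hB0 : B ≠ 0) (h : poisson B A = 0) :
    ∃ c r s : F, A = C c * (C r * X 0 + C s * X 1) ^ n := by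
  obtain ⟨k, hk⟩ := exists_pow_eq_of_poisson_eq_zero hB hA hB0 h
  have ha := dehomogenize_ne_zero hA hA0
  have hk0 : k ≠ 0 := by
    rintro rfl
    simp [ha] at hk
  obtain ⟨c, q, hq⟩ := exists_eq_C_mul_pow_of_pow_eq hn hmn ha hk0 hk
  have hc : c ≠ 0 := by
    rintro rfl
    simp [ha] at hq
  -- A form of degree `n` dehomogenizes to degree at most `n`, so its `n`-th root is at most linear.
  have hd : q.natDegree ≤ 1 := by
    have := natDegree_dehomogenize_le hA
    rw [hq, Polynomial.natDegree_C_mul hc, Polynomial.natDegree_pow] at this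
    exact le_of_mul_le_mul_left (by omega) (show 0 < n by omega)
  obtain ⟨s, r, rfl⟩ := Polynomial.exists_eq_X_add_C_of_natDegree_le_one hd
  have hlin : (C r * X 0 + C s * X 1 : MvPolynomial (Fin 2) F).IsHomogeneous 1 :=
    (isHomogeneous_C_mul_X _ _).add (isHomogeneous_C_mul_X _ _)
  refine ⟨c, r, s, dehomogenize_injOn hA ?_ ?_⟩
  · simpa using (hlin.pow n).C_mul c
  · rw [hq]
    simp [dehomogenize, add_comm]

theorem exists_homogeneousComponent_ne_zero {n : ℤ} {D : MvPolynomial (Fin 2) F} (hD : D ≠ 0)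
    (hn : D ∈ degreeLE F n) :
    ∃ m : ℕ, (m : ℤ) ≤ n ∧ D ∈ degreeLE F m ∧ homogeneousComponent m D ≠ 0 := by
  obtain ⟨k, hk, hmax⟩ := Finset.exists_max_image D.support Finsupp.degree (support_nonempty.2 hD)
  rw [mem_support_iff] at hk
  refine ⟨k.degree, hn k hk, fun m hm => ?_, fun h => hk ?_⟩
  · exact_mod_cast hmax m (mem_support_iff.2 hm)
  · simpa [coeff_homogeneousComponent] using congrArg (coeff k) h

theorem eq_C_of_mem_degreeLE_zero {D : MvPolynomial (Fin 2) F} (hD : D ∈ degreeLE F 0) :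
    D = C (coeff 0 D) := by
  ext m
  rw [coeff_C]
  split_ifs with h
  · rw [h]
  · by_contra hm
    have := hD m hm
    exact h ((Finsupp.degree_eq_zero_iff m).1 (by omega)).symm

/-! ### Leading terms as homogeneous components, and symmetric powers of linear forms -/

theorem weight_one_one (m : Fin 2 →₀ ℕ) : weight 1 1 m = m.degree := by
  rw [weight, degree_fin_two]
  push_cast
  ring

theorem mem_degreeLE_of_polyDegree_eq {n : ℕ} {P : MvPolynomial (Fin 2) F}
    (h : polyDegree 1 1 P = ((n : ℤ) : WithBot ℤ)) : P ∈ degreeLE F n := by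
  intro m hm
  have h1 : (weight 1 1 m : WithBot ℤ) ≤ polyDegree 1 1 P :=
    Finset.le_sup (f := fun m => (weight 1 1 m : WithBot ℤ)) (mem_support_iff.2 hm)
  rw [h, weight_one_one] at h1
  exact_mod_cast h1

theorem homogeneousComponent_ne_zero_of_polyDegree_eq {n : ℕ} {P : MvPolynomial (Fin 2) F}
    (h : polyDegree 1 1 P = ((n : ℤ) : WithBot ℤ)) : homogeneousComponent n P ≠ 0 := by
  have hne : P.support.Nonempty := by
    by_contra h0
    rw [Finset.not_nonempty_iff_eq_empty] at h0
    simp [polyDegree, h0] at h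
  obtain ⟨m, hm, he⟩ := Finset.exists_mem_eq_sup P.support hne
    (fun m => (weight 1 1 m : WithBot ℤ))
  have h1 : (weight 1 1 m : WithBot ℤ) = ((n : ℤ) : WithBot ℤ) := by rw [← h]; exact he.symm
  rw [weight_one_one] at h1
  have h2 : m.degree = n := by exact_mod_cast h1
  intro h0
  have h3 := congrArg (coeff m) h0
  rw [coeff_homogeneousComponent, if_pos h2] at h3
  exact mem_support_iff.1 hm (by simpa using h3)

theorem polyLeadingTerm_eq_homogeneousComponent {n : ℕ} {P : MvPolynomial (Fin 2) F}
    (h : polyDegree 1 1 P = ((n : ℤ) : WithBot ℤ)) :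
    polyLeadingTerm 1 1 P = homogeneousComponent n P := by
  rw [polyLeadingTerm, homogeneousComponent_apply, h]
  refine Finset.sum_congr (Finset.filter_congr fun m _ => ?_) fun _ _ => rfl
  rw [weight_one_one]
  norm_cast

/-- A nonzero power of a linear form that the exchange of variables multiplies by `c`. -/
theorem linear_form_of_swap_eq [CharZero F] {n : ℕ} (hn : Odd n) {A : MvPolynomial (Fin 2) F}
    (hA0 : A ≠ 0) {k r s c : F} (hA : A = C k * (C r * X 0 + C s * X 1) ^ n)
    (hswap : rename (Equiv.swap 0 1) A = C c * A) :
    ∃ l : F, l ≠ 0 ∧ A = C l * (X 0 + C c * X 1) ^ n := by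
  have hn0 : n ≠ 0 := by
    rintro rfl
    simp at hn
  have hk : k ≠ 0 := by
    rintro rfl
    simp [hA0] at hA
  have hev : ∀ x y : F, (r * y + s * x) ^ n = c * (r * x + s * y) ^ n := by
    intro x y
    have h := congrArg (eval ![x, y]) hswap
    rw [hA] at h
    simp at h
    exact mul_left_cancel₀ hk (by linear_combination h)
  -- The linear form vanishes at `(s, -r)`, so by symmetry it vanishes at `(-r, s)`.
  have h1 : (s - r) * (s + r) = 0 := by
    have := hev s (-r)
    rw [show r * s + s * -r = 0 by ring, zero_pow hn0, mul_zero] at this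
    linear_combination pow_eq_zero_iff hn0 |>.1 this
  have h2 : s ^ n = c * r ^ n := by simpa using hev 1 0
  have hr : r ≠ 0 := by
    rintro rfl
    have hs : s = 0 := by simpa using h1
    exact hA0 (by rw [hA, hs]; simp [hn0])
  have hrn : r ^ n ≠ 0 := pow_ne_zero _ hr
  have hs : s = c * r := by
    rcases mul_eq_zero.1 h1 with h | h
    · have h3 : s = r := by linear_combination h
      subst h3
      have : c = 1 := mul_right_cancel₀ hrn (by linear_combination -h2)
      rw [this, one_mul]
    · have h3 : s = -r := by linear_combination h
      subst h3
      -- Oddness of `n` turns the sign of the linear form into `c = -1`.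
      rw [hn.neg_pow] at h2
      have : c = -1 := mul_right_cancel₀ hrn (by linear_combination -h2)
      rw [this]
      ring
  refine ⟨k * r ^ n, mul_ne_zero hk hrn, ?_⟩
  rw [hA, hs, C_mul (a := k), C_pow, mul_assoc, ← mul_pow, C_mul]
  congr 2
  ring

end Weyl

/-! ### The main theorem -/

theorem mainTheorem3 {F : Type*} [Field F] [CharZero F]
    (f : Weyl.A1 F →ₐ[F] Weyl.A1 F) (hf : Weyl.IsAlphaEndomorphism f)
    (p : ℕ) (hp : p.Prime) (hp2 : 2 < p) (hdeg : Weyl.HasDegree f p)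
    (P : Weyl.A1 F) (hP : f (Weyl.x F) = P) :
    Weyl.IsAntisymmetric (Weyl.normalOrder F (Weyl.leadingTerm 1 1 P)) ∧
      ∃ c : F, c ≠ 0 ∧
        Weyl.leadingTerm 1 1 P =
          MvPolynomial.C c * (MvPolynomial.X 0 - MvPolynomial.X 1) ^ p := by
  open Weyl MvPolynomial in
  subst hP
  set U := Theta F (f (x F)) with hU
  have hinv : ∀ S : MvPolynomial (Fin 2) F,
      rename (Equiv.swap 0 1) (rename (Equiv.swap (0 : Fin 2) 1) S) = S := by
    intro S
    rw [rename_rename, ← Equiv.coe_trans, Equiv.swap_swap]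
    exact rename_id_apply S
  have hy : Theta F (f (y F)) = rename (Equiv.swap 0 1) U := by
    rw [← exchange_x, hf, Theta_exchange]
  have hUp : U ∈ degreeLE F p := mem_degreeLE_of_polyDegree_eq hdeg
  set A := homogeneousComponent p U with hA
  have hA0 : A ≠ 0 := homogeneousComponent_ne_zero_of_polyDegree_eq hdeg
  have hAh : A.IsHomogeneous p := homogeneousComponent_isHomogeneous _ _
  have hlead : leadingTerm 1 1 (f (x F)) = A := polyLeadingTerm_eq_homogeneousComponent hdeg
  have hswapA : homogeneousComponent p (rename (Equiv.swap 0 1) U) =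
      rename (Equiv.swap 0 1) A := by
    rw [hA, rename_homogeneousComponent]
  have hVp : rename (Equiv.swap 0 1) U ∈ degreeLE F p := by
    intro m hm
    obtain ⟨k, rfl, hk⟩ := coeff_rename_ne_zero _ _ _ hm
    rw [Finsupp.degree_mapDomain]
    exact hUp k hk
  have hcomm : f (y F) * f (x F) - f (x F) * f (y F) = 1 := by
    rw [← map_mul, ← map_mul, y_mul_x, map_add, map_one, add_sub_cancel_left]
  obtain ⟨c, hc⟩ : ∃ c : F, rename (Equiv.swap 0 1) A = C c * A := by
    have h0 := poisson_homogeneousComponent_eq_zero (by omega) (by omega) (by omega)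
      (hy ▸ hVp) hUp hcomm
    rw [hy, hswapA, ← hU, ← hA] at h0
    refine exists_eq_C_mul_of_poisson_eq_zero (by omega) hAh hAh.rename_isHomogeneous hA0 ?_
    rw [poisson] at h0 ⊢
    linear_combination -h0
  have hcsq : c = 1 ∨ c = -1 := by
    have h1 := hinv A
    rw [hc, map_mul, rename_C, hc] at h1
    have h2 : C (c * c - 1) * A = 0 := by
      rw [C_sub, C_mul, C_1]
      linear_combination h1
    have h3 : c * c - 1 = 0 := (map_eq_zero_iff C (C_injective _ _)).1
      ((mul_eq_zero.1 h2).resolve_right hA0)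
    exact mul_self_eq_one_iff.1 (by linear_combination h3)
  -- Subtracting `c U` kills the top form and leaves the commutator with `f x` unchanged.
  set D := rename (Equiv.swap 0 1) U - c • U with hD
  have hDTheta : Theta F (f (y F) - c • f (x F)) = D := by
    rw [map_sub, map_smul, hy]
  have hDcomm : (f (y F) - c • f (x F)) * f (x F) - f (x F) * (f (y F) - c • f (x F)) = 1 := by
    rw [← hcomm, sub_mul, mul_sub, smul_mul_assoc, mul_smul_comm]
    abel
  have hnontriv : (1 : A1 F) ≠ 0 := by
    intro h
    have h1 : normalOrder F 1 = normalOrder F 0 :=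
      (mul_one _).symm.trans (by rw [h, mul_zero, map_zero])
    exact one_ne_zero ((normalOrder_bijective F).1 h1)
  have hD0 : D ≠ 0 := by
    intro h
    have : f (y F) - c • f (x F) = 0 := (Theta F).injective (by rw [hDTheta, h, map_zero])
    rw [this] at hDcomm
    simp [hnontriv.symm] at hDcomm
  have hDp : D ∈ degreeLE F (p - 1) := by
    have h1 := sub_homogeneousComponent_mem_degreeLE
      (sub_mem hVp (Submodule.smul_mem _ c hUp))
    rwa [map_sub, map_smul, hswapA, ← hA, hc, ← smul_eq_C_mul, sub_self, sub_zero] at h1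
  obtain ⟨m, hmp, hDm, hB0⟩ := exists_homogeneousComponent_ne_zero hD0 hDp
  -- For `m = 0` the element would be a scalar, hence central, against its commutator being `1`.
  have hm0 : 0 < m := by
    rcases Nat.eq_zero_or_pos m with rfl | h
    · have h1 := eq_C_of_mem_degreeLE_zero hDm
      rw [← hDTheta] at h1
      have h2 := normalOrder_Theta (f (y F) - c • f (x F))
      rw [h1, ← mul_one (C _), ← smul_eq_C_mul, map_smul] at h2
      have h3 : normalOrder F 1 = 1 := by
        rw [← C_1, C_apply, normalOrder_monomial]
        simp
      rw [h3] at h2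
      rw [← h2] at hDcomm
      simp [hnontriv.symm] at hDcomm
    · exact h
  set B := homogeneousComponent m D with hB
  have hBh : B.IsHomogeneous m := homogeneousComponent_isHomogeneous _ _
  have hBA : poisson B A = 0 := by
    have h0 := poisson_homogeneousComponent_eq_zero hm0 (by omega : 0 < p) (by omega)
      (hDTheta ▸ hDm) hUp hDcomm
    rwa [hDTheta] at h0
  have hcop : m.Coprime p := (Nat.coprime_of_lt_prime hm0.ne' (by omega) hp).symm
  obtain ⟨k, r, s, hlin⟩ :=
    exists_eq_linear_pow_of_poisson_eq_zero (by omega) hcop hAh hBh hA0 hB0 hBA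
  have hodd : Odd p := hp.odd_of_ne_two (by omega)
  obtain ⟨l, hl, hAl⟩ := linear_form_of_swap_eq hodd hA0 hlin hc
  have hc1 : c = -1 := by
    refine hcsq.resolve_left fun hc1 => ?_
    have hDswap : rename (Equiv.swap 0 1) D = -D := by
      rw [hD, hc1, one_smul, map_sub, hinv, neg_sub]
    have hBswap : rename (Equiv.swap 0 1) B = -B := by
      rw [hB, rename_homogeneousComponent, hDswap, map_neg]
    have hB1 : eval (fun _ => (1 : F)) B = 0 := by
      have h1 := congrArg (eval fun _ => (1 : F)) hBswap
      rw [eval_rename, map_neg] at h1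
      exact self_eq_neg.1 h1
    obtain ⟨q, hq⟩ := exists_pow_eq_of_poisson_eq_zero hBh hAh hB0 hBA
    have h2 := congrArg (Polynomial.eval 1) hq
    rw [Polynomial.eval_mul, Polynomial.eval_pow, Polynomial.eval_pow, eval_one_dehomogenize,
      eval_one_dehomogenize, hB1, hAl, hc1, zero_pow (by omega), mul_zero] at h2
    have h3 := (pow_eq_zero_iff hm0.ne').1 h2
    simp [hl] at h3
  subst hc1
  rw [hlead]
  refine ⟨?_, l, hl, ?_⟩
  · apply (Theta F).injective
    rw [Theta_exchange, map_neg, Theta_normalOrder, hc]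
    simp
  · rw [hAl]
    congr 2
    simp [sub_eq_add_neg]
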